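/- Let $A$ be a finite alphabet. A *prevariety* is a set $\mathcal C$ of regular languages over $A$ that contains $\emptyset$ and $A^*$, is closed under union, intersection and complement, and such that $u^{-1}L=\{w\mid uw\in L\}$ and $Lu^{-1}=\{w\mid wu\in L\}$ belong to $\mathcal C$ for all $L\in\mathcal C$, $u\in A^*$. Let $\mathrm{UPol}(\mathcal C)$ be the least class of languages that contains $\mathcal C$ and is closed under disjoint union ($K\cup L$ with $K\cap L=\emptyset$) and unambiguous marked concatenation ($KaL$ with $a\in A$, such that $uav=u'av'$ with $u,u'\in K$, $v,v'\in L$ implies $u=u'$ and $v=v'$). For a finite prevariety $\mathcal C$ (that is, one with finitely many languages), the *canonical $\mathcal C$-morphism* $\eta_{\mathcal C}:A^*\to N_{\mathcal C}$ is the surjective morphism onto a finite monoid, unique up to isomorphism, such that the languages $\eta_{\mathcal C}^{-1}(F)$, $F\subseteq N_{\mathcal C}$, are exactly the languages in $\mathcal C$. A *multiplicative rating map* is a semiring morphism $\rho:(2^{A^*},\cup,\cdot)\to(R,+,\cdot)$ into a finite idempotent semiring $R$ (for which $r\le s$ means $r+s=s$); write $\rho(w)=\rho(\{w\})$. The *$\rho$-imprint*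 of a finite set $\mathbf K$ of languages is $\{r\in R\mid r\le\rho(K)\text{ for some }K\in\mathbf K\}$. For a class $\mathcal D$ of languages, a *$\mathcal D$-cover* of a language $L$ is a finite set $\mathbf K\subseteq\mathcal D$ with $L\subseteq\bigcup_{K\in\mathbf K}K$. It is *optimal* for $\rho$ if its $\rho$-imprint is included in that of every $\mathcal D$-cover of $L$. The *$\mathcal D$-optimal $\rho$-imprint on $L$*, denoted $\mathcal I_{\mathcal D}[L,\rho]$, is the $\rho$-imprint of any optimal $\mathcal D$-cover of $L$. For a morphism $\eta:A^*\to N$ into a finite monoid, the *$\eta$-pointed $\mathcal D$-optimal $\rho$-imprint* is $\mathcal P_{\mathcal D}[\eta,\rho]=\{(t,r)\in N\times R\mid r\in\mathcal I_{\mathcal D}[\eta^{-1}(t),\rho]\}$. A set $S\subseteq N\times R$ is *UPol-saturated for $\eta$ and $\rho$* if: 1. (trivial elements) $(\eta(w),\rho(w))\in S$ for every $w\in A^*$; 2. (downset) if $(s,r)\in S$ and $r'\le r$, then $(s,r')\in S$; 3. (multiplication) if $(s_1,r_1),(s_2,r_2)\in S$, then $(s_1s_2,r_1r_2)\in S$;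 4. (UPol-closure) if $(e_1,f_1),(e_2,f_2)\in S$ with $e_1,e_2$ idempotent in $N$ and $f_1,f_2$ multiplicatively idempotent in $R$, and $s\in N$ satisfies $e_1\in se_2N$ and $e_2\in Ne_1s$, then $(e_1se_2,\ f_1\,\rho(\eta^{-1}(s))\,f_2)\in S$. **Theorem.** Let $\mathcal C$ be a finite prevariety and let $\rho:2^{A^*}\to R$ be a multiplicative rating map. Then $\mathcal P_{\mathrm{UPol}(\mathcal C)}[\eta_{\mathcal C},\rho]$ is the least (for inclusion) UPol-saturated subset of $N_{\mathcal C}\times R$ for $\eta_{\mathcal C}$ and $\rho$. -/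

import Mathlib

namespace UPolImprint

/-! ## Classes of languages -/

section Classes

variable {A : Type*}

/-- The right quotient `L u⁻¹ = {w | w u ∈ L}`. (The left quotient `u⁻¹ L = {w | u w ∈ L}` is
`Language.leftQuotient`.) -/
def rightQuotient (L : Language A) (u : List A) : Language A := {w : List A | w ++ u ∈ L}

/-- A prevariety: a Boolean algebra of regular languages that is closed under quotients.
Here `0` is the empty language, `⊤` is `A*`, `+` is union and `⊓` is intersection. -/
structure IsPrevariety (C : Set (Language A)) : Prop where
  empty_mem : (0 : Language A) ∈ C
  univ_mem : (⊤ : Language A) ∈ C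
  union_mem : ∀ K ∈ C, ∀ L ∈ C, K + L ∈ C
  inter_mem : ∀ K ∈ C, ∀ L ∈ C, K ⊓ L ∈ C
  compl_mem : ∀ L ∈ C, Lᶜ ∈ C
  leftQuotient_mem : ∀ L ∈ C, ∀ u : List A, L.leftQuotient u ∈ C
  rightQuotient_mem : ∀ L ∈ C, ∀ u : List A, rightQuotient L u ∈ C
  regular : ∀ L ∈ C, L.IsRegular

/-- The marked concatenation `K a L`. -/
def markedConcat (K : Language A) (a : A) (L : Language A) : Language A :=
  K * ({[a]} : Language A) * L

/-- The marked concatenation of `K`, `a` and `L` is unambiguous: each of its words has a unique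
decomposition. -/
def IsUnambiguous (K : Language A) (a : A) (L : Language A) : Prop :=
  ∀ u ∈ K, ∀ u' ∈ K, ∀ v ∈ L, ∀ v' ∈ L,
    u ++ [a] ++ v = u' ++ [a] ++ v' → u = u' ∧ v = v'

/-- Membership in the least class containing `C` and closed under disjoint union and unambiguous
marked concatenation. -/
inductive MemUPol (C : Set (Language A)) : Language A → Prop
  | base {L : Language A} : L ∈ C → MemUPol C L
  | disjointUnion {K L : Language A} : MemUPol C K → MemUPol C L → K ⊓ L = 0 →
      MemUPol C (K + L)
  | unambiguousConcat {K L : Language A} {a : A} : MemUPol C K → MemUPol C L →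
      IsUnambiguous K a L → MemUPol C (markedConcat K a L)

/-- The unambiguous polynomial closure of `C`. -/
def UPol (C : Set (Language A)) : Set (Language A) := {L | MemUPol C L}

end Classes

/-! ## Morphisms into finite monoids -/

section Morphisms

variable {A N : Type*} [Monoid N]

/-- The language `η⁻¹(F)` recognized by `η` through the accepting set `F`. -/
def recognized (η : FreeMonoid A →* N) (F : Set N) : Language A :=
  {w : List A | η (FreeMonoid.ofList w) ∈ F}

/-- A `C`-morphism (for a prevariety `C`): a surjective morphism into a finite monoid such that all
the languages it recognizes are in `C`. -/
structure IsCMorphism (C : Set (Language A)) (η : FreeMonoid A →* N) : Prop where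
  finite : Finite N
  surjective : Function.Surjective η
  recognized_mem : ∀ F : Set N, recognized η F ∈ C

/-- The canonical `C`-morphism: the `C`-morphism that recognizes all languages in `C`. For a finite
prevariety it exists and is unique up to renaming, see `isCanonicalMorphism_canonicalMorphism` and
`IsCanonicalMorphism.exists_mulEquiv`. -/
structure IsCanonicalMorphism (C : Set (Language A)) (η : FreeMonoid A →* N) : Prop
    extends IsCMorphism C η where
  recognizes : ∀ L ∈ C, ∃ F : Set N, L = recognized η F

/-- `s ≤_R t` for the Green preorder: `s = t y` for some `y`. -/
def GreenRLE (s t : N) : Prop := ∃ y : N, s = t * y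

/-- `s ≤_L t` for the Green preorder: `s = x t` for some `x`. -/
def GreenLLE (s t : N) : Prop := ∃ x : N, s = x * t

end Morphisms

/-! ## Existence and uniqueness of the canonical morphism -/

section Canonical

variable {A : Type*}

/-- The congruence on `A*` which relates two words when no language in `C` distinguishes them in
any context. -/
def canonicalCon (C : Set (Language A)) : Con (FreeMonoid A) where
  r u v := ∀ L ∈ C, ∀ x y : FreeMonoid A,
    FreeMonoid.toList (x * u * y) ∈ L ↔ FreeMonoid.toList (x * v * y) ∈ L
  iseqv :=
    { refl := fun _ _ _ _ _ => Iff.rfl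
      symm := fun h L hL x y => (h L hL x y).symm
      trans := fun h₁ h₂ L hL x y => (h₁ L hL x y).trans (h₂ L hL x y) }
  mul' := by
    intro u u' v v' h₁ h₂ L hL x y
    have e₁ := h₁ L hL x (v * y)
    have e₂ := h₂ L hL (x * u') y
    simp only [mul_assoc] at e₁ e₂ ⊢
    exact e₁.trans e₂

/-- The projection of `A*` onto its quotient by `canonicalCon C`. -/
def canonicalMorphism (C : Set (Language A)) : FreeMonoid A →* (canonicalCon C).Quotient :=
  (canonicalCon C).mk'

theorem canonicalMorphism_eq_iff {C : Set (Language A)} (hC : IsPrevariety C)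
    (u v : FreeMonoid A) : canonicalMorphism C u = canonicalMorphism C v ↔
      ∀ L ∈ C, FreeMonoid.toList u ∈ L ↔ FreeMonoid.toList v ∈ L := by
  refine (Con.eq (canonicalCon C)).trans ⟨fun h L hL => ?_, fun h L hL x y => ?_⟩
  · simpa using h L hL 1 1
  · have := h _ (hC.leftQuotient_mem _ (hC.rightQuotient_mem L hL (FreeMonoid.toList y))
      (FreeMonoid.toList x))
    exact this

theorem isCanonicalMorphism_canonicalMorphism {C : Set (Language A)} (hC : IsPrevariety C)
    (hfin : C.Finite) : IsCanonicalMorphism C (canonicalMorphism C) := by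
  classical
  have hsurj : Function.Surjective (canonicalMorphism C) := Con.mk'_surjective
  have hN : Finite (canonicalCon C).Quotient := by
    have : Finite C := hfin
    obtain ⟨g, hg⟩ := hsurj.hasRightInverse
    refine Finite.of_injective
      (fun q => ({L | FreeMonoid.toList (g q) ∈ (L : Language A)} : Set C)) fun p q hpq => ?_
    rw [← hg p, ← hg q, canonicalMorphism_eq_iff hC]
    intro L hL
    exact Set.ext_iff.1 hpq ⟨L, hL⟩
  have hinter : ∀ s : Set (Language A), s.Finite → s ⊆ C →
      ({w : List A | ∀ L ∈ s, w ∈ L} : Language A) ∈ C := by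
    intro s hs
    induction s, hs using Set.Finite.induction_on with
    | empty =>
      intro _
      refine Set.mem_of_eq_of_mem ?_ hC.univ_mem
      apply Language.ext
      intro w
      exact ⟨fun _ => trivial, fun _ L hL => absurd hL (Set.notMem_empty L)⟩
    | @insert K s _ _ ih =>
      intro hs
      refine Set.mem_of_eq_of_mem ?_ (hC.inter_mem K (hs (Set.mem_insert _ _)) _
        (ih fun L hL => hs (Set.mem_insert_of_mem _ hL)))
      apply Language.ext
      intro w
      constructor
      · intro h
        exact ⟨h K (Set.mem_insert _ _), fun L hL => h L (Set.mem_insert_of_mem _ hL)⟩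
      · rintro ⟨h₁, h₂⟩ L (rfl | hL)
        · exact h₁
        · exact h₂ L hL
  have hclass : ∀ q, recognized (canonicalMorphism C) {q} ∈ C := by
    intro q
    obtain ⟨u, rfl⟩ := hsurj q
    refine Set.mem_of_eq_of_mem ?_ (hinter {L ∈ C | FreeMonoid.toList u ∈ L} (hfin.subset fun _ h => h.1)
      fun _ h => h.1)
    apply Language.ext
    intro w
    refine (canonicalMorphism_eq_iff hC (FreeMonoid.ofList w) u).trans ⟨?_, ?_⟩
    · intro h L hL
      exact (h L hL.1).2 hL.2
    · intro h L hL
      refine ⟨fun hw => ?_, fun hu => h L ⟨hL, hu⟩⟩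
      by_contra hu
      exact h Lᶜ ⟨hC.compl_mem L hL, hu⟩ hw
  refine ⟨⟨hN, hsurj, fun F => ?_⟩, fun L hL => ?_⟩
  · induction F, F.toFinite using Set.Finite.induction_on with
    | empty => exact hC.empty_mem
    | @insert q F _ _ ih => exact hC.union_mem _ (hclass q) _ ih
  · refine ⟨canonicalMorphism C '' {u | FreeMonoid.toList u ∈ L}, ?_⟩
    ext w
    constructor
    · intro hw
      exact ⟨FreeMonoid.ofList w, hw, rfl⟩
    · rintro ⟨u, hu, huw⟩
      exact ((canonicalMorphism_eq_iff hC u (FreeMonoid.ofList w)).1 huw L hL).1 hu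

theorem IsCanonicalMorphism.exists_mulEquiv {C : Set (Language A)} {M N : Type*} [Monoid M]
    [Monoid N] {α : FreeMonoid A →* M} {η : FreeMonoid A →* N} (hα : IsCanonicalMorphism C α)
    (hη : IsCanonicalMorphism C η) : ∃ γ : M ≃* N, ∀ w, γ (α w) = η w := by
  have key : ∀ u v, α u = α v ↔ η u = η v := by
    intro u v
    constructor
    · intro h
      obtain ⟨F, hF⟩ := hα.recognizes _ (hη.recognized_mem {η u})
      have hu : FreeMonoid.toList u ∈ recognized η {η u} := rfl
      have hv : FreeMonoid.toList v ∈ recognized η {η u} := by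
        rw [hF] at hu ⊢
        change α v ∈ F
        exact h ▸ hu
      exact (show η v = η u from hv).symm
    · intro h
      obtain ⟨F, hF⟩ := hη.recognizes _ (hα.recognized_mem {α u})
      have hu : FreeMonoid.toList u ∈ recognized α {α u} := rfl
      have hv : FreeMonoid.toList v ∈ recognized α {α u} := by
        rw [hF] at hu ⊢
        change η v ∈ F
        exact h ▸ hu
      exact (show α v = α u from hv).symm
  obtain ⟨g, hg⟩ := hα.surjective.hasRightInverse
  have hγ : ∀ w, η (g (α w)) = η w := fun w => (key _ _).1 (hg (α w))
  let γ : M →* N :=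
    { toFun := fun m => η (g m)
      map_one' := by simpa using hγ 1
      map_mul' := fun m n => by
        rw [← map_mul, ← key, map_mul, hg, hg, hg] }
  refine ⟨MulEquiv.ofBijective γ ⟨fun m n h => ?_, fun n => ?_⟩, hγ⟩
  · rw [← hg m, ← hg n]
    exact (key _ _).2 h
  · obtain ⟨w, rfl⟩ := hη.surjective n
    exact ⟨α w, hγ w⟩

end Canonical

/-! ## Rating maps and optimal imprints

A multiplicative rating map is a semiring morphism `ρ : Language A →+* R` into a finite idempotent
semiring `R`; addition of languages is union and multiplication is concatenation. In an
`IdemSemiring`, `r ≤ s` means `r + s = s`. -/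

section Imprints

variable {A R : Type*} [IdemSemiring R]

/-- The finite set `K` is a cover of `L`. -/
def IsCover (K : Finset (Language A)) (L : Language A) : Prop := ∀ w ∈ L, ∃ H ∈ K, w ∈ H

/-- The finite set `K` is a `D`-cover of `L`. -/
def IsCoverIn (D : Set (Language A)) (K : Finset (Language A)) (L : Language A) : Prop :=
  IsCover K L ∧ ∀ H ∈ K, H ∈ D

/-- The `ρ`-imprint of `K`: the downset of `{ρ(H) | H ∈ K}`. -/
def imprint (ρ : Language A →+* R) (K : Finset (Language A)) : Set R :=
  {r | ∃ H ∈ K, r ≤ ρ H}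

/-- `K` is an optimal `D`-cover of `L` for `ρ`. -/
def IsOptimalCover (D : Set (Language A)) (ρ : Language A →+* R) (K : Finset (Language A))
    (L : Language A) : Prop :=
  IsCoverIn D K L ∧ ∀ K' : Finset (Language A), IsCoverIn D K' L → imprint ρ K ⊆ imprint ρ K'

/-- The `D`-optimal `ρ`-imprint on `L`: the imprint of any optimal `D`-cover of `L`, see
`IsOptimalCover.optimalImprint_eq`. -/
def optimalImprint (D : Set (Language A)) (L : Language A) (ρ : Language A →+* R) : Set R :=
  {r | ∃ K : Finset (Language A), IsOptimalCover D ρ K L ∧ r ∈ imprint ρ K}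

theorem IsOptimalCover.optimalImprint_eq {D : Set (Language A)} {ρ : Language A →+* R}
    {K : Finset (Language A)} {L : Language A} (h : IsOptimalCover D ρ K L) :
    optimalImprint D L ρ = imprint ρ K :=
  Set.Subset.antisymm (fun _ ⟨_, hK', hr⟩ => hK'.2 K h.1 hr) fun _ hr => ⟨K, h, hr⟩

variable {N : Type*} [Monoid N]

/-- The `η`-pointed `D`-optimal `ρ`-imprint. -/
def pointedOptimalImprint (D : Set (Language A)) (η : FreeMonoid A →* N) (ρ : Language A →+* R) :
    Set (N × R) :=
  {p | p.2 ∈ optimalImprint D (recognized η {p.1}) ρ}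

/-- The downset of `S ⊆ X × R` in the second component. -/
def downsetSnd {X : Type*} (S : Set (X × R)) : Set (X × R) :=
  {p | ∃ s : R, p.2 ≤ s ∧ (p.1, s) ∈ S}

/-- `S` is `UPol`-saturated for `η` and `ρ`. -/
structure IsUPolSaturated (η : FreeMonoid A →* N) (ρ : Language A →+* R) (S : Set (N × R)) :
    Prop where
  trivial_mem : ∀ w : List A, (η (FreeMonoid.ofList w), ρ ({w} : Language A)) ∈ S
  downset_eq : downsetSnd S = S
  mul_mem : ∀ s₁ s₂ : N, ∀ r₁ r₂ : R, (s₁, r₁) ∈ S → (s₂, r₂) ∈ S → (s₁ * s₂, r₁ * r₂) ∈ S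
  upol_closure : ∀ e₁ e₂ : N, ∀ f₁ f₂ : R, (e₁, f₁) ∈ S → (e₂, f₂) ∈ S →
    IsIdempotentElem e₁ → IsIdempotentElem f₁ → IsIdempotentElem e₂ → IsIdempotentElem f₂ →
    ∀ s : N, GreenRLE e₁ (s * e₂) → GreenLLE e₂ (e₁ * s) →
      (e₁ * s * e₂, f₁ * ρ (recognized η {s}) * f₂) ∈ S

end Imprints

end UPolImprint

namespace UPolImprint

/-! ## Languages in the unambiguous polynomial closure: a swapping property -/

section Swap

variable {A N : Type*} [Monoid N]

/-! Let `S` be the intersection of all saturated sets. Two facts give the theorem: every `UPol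
C`-cover of `η⁻¹(t)` has all `r` with `(t, r) ∈ S` in its imprint, and some cover has only these.

For the first, languages of `UPol C` are swap-stable (`MemUPol.isSwapStable`): between high powers
of `u` and `w`, they see only the image of a factor under `η`. Given finitely many such languages,
the pairs `(η w, r)` with `r ≤ ρ([w])`, where `[w]` is the class of `w` for their joint syntactic
congruence, form a saturated set (`isUPolSaturated_classImprint`). It contains `S`, and each class
lies in every member of the cover that it meets.

For the second, `hasCover` builds covers inside a context `p, q ∈ S`, by induction on the number of
elements `J`-above `t` and then on the sizes of `pS` and `Sq`. If suitable idempotents of `S`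
stabilize `p` and `q`, the closure axiom shows that `η⁻¹(t)` alone suffices. Otherwise words are cut
at the letter where a prefix or suffix first drops `J`-below `t`. Such a cut is unambiguous and
either moves `t` up or shrinks an ideal. -/

/-- Sufficiently high powers of words `u` and `w` with idempotent images allow swapping two words
with the same image `s` between them, when `η u ≤_R s η w` and `η w ≤_L η u s`. -/
def IsSwapStable (η : FreeMonoid A →* N) (L : Language A) : Prop :=
  ∃ n : ℕ, ∀ i ≥ n, ∀ j ≥ n, ∀ u w : FreeMonoid A, IsIdempotentElem (η u) →
    IsIdempotentElem (η w) → ∀ v v' : FreeMonoid A, η v = η v' → GreenRLE (η u) (η v * η w) →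
    GreenLLE (η w) (η u * η v) → ∀ x y : FreeMonoid A,
      (x * u ^ i * v * w ^ j * y).toList ∈ L → (x * u ^ i * v' * w ^ j * y).toList ∈ L

theorem isSwapStable_recognized (η : FreeMonoid A →* N) (F : Set N) :
    IsSwapStable η (recognized η F) := by
  refine ⟨0, fun i _ j _ u w _ _ v v' hv _ _ x y h => ?_⟩
  change η _ ∈ F at h
  change η _ ∈ F
  simpa [hv] using h

theorem IsSwapStable.add {η : FreeMonoid A →* N} {K L : Language A} (hK : IsSwapStable η K)
    (hL : IsSwapStable η L) : IsSwapStable η (K + L) := by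
  obtain ⟨m, hm⟩ := hK
  obtain ⟨n, hn⟩ := hL
  refine ⟨m + n, fun i hi j hj u w hu hw v v' hv hr hl x y h => h.imp ?_ ?_⟩
  · exact hm i (by omega) j (by omega) u w hu hw v v' hv hr hl x y
  · exact hn i (by omega) j (by omega) u w hu hw v v' hv hr hl x y

theorem mem_markedConcat {K L : Language A} {a : A} {w : FreeMonoid A} :
    w.toList ∈ markedConcat K a L ↔ ∃ k l : FreeMonoid A, k.toList ∈ K ∧ l.toList ∈ L ∧
      k * FreeMonoid.of a * l = w := by
  constructor
  · rintro ⟨_, ⟨k, hk, _, rfl, rfl⟩, l, hl, h⟩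
    exact ⟨k, l, hk, hl, h⟩
  · rintro ⟨k, l, hk, hl, rfl⟩
    exact ⟨_, ⟨k.toList, hk, [a], rfl, rfl⟩, l.toList, hl, rfl⟩

/-- A marker in a product of two words lies in one of the two factors. -/
theorem mul_eq_mul_of_mul {p q k l : FreeMonoid A} {a : A} (h : p * q = k * FreeMonoid.of a * l) :
    (∃ z, p = k * FreeMonoid.of a * z ∧ l = z * q) ∨
      ∃ z, k = p * z ∧ q = z * FreeMonoid.of a * l := by
  have h' : p.toList ++ q.toList = k.toList ++ (a :: l.toList) := by
    have := congrArg FreeMonoid.toList h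
    simpa using this
  rcases List.append_eq_append_iff.1 h' with ⟨z, h₁, h₂⟩ | ⟨z, h₁, h₂⟩
  · right
    refine ⟨FreeMonoid.ofList z, h₁, ?_⟩
    apply FreeMonoid.toList.injective
    simpa using h₂
  · rcases z with _ | ⟨b, z⟩
    · right
      refine ⟨1, ?_, ?_⟩
      · apply FreeMonoid.toList.injective
        simpa using h₁.symm
      · apply FreeMonoid.toList.injective
        simpa using h₂.symm
    · left
      simp only [List.cons_append, List.cons.injEq] at h₂
      obtain ⟨rfl, h₂⟩ := h₂
      refine ⟨FreeMonoid.ofList z, ?_, h₂⟩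
      apply FreeMonoid.toList.injective
      simpa using h₁

/-- If `e ≤_R s f` and `f ≤_L e s`, then `e s f` has an inverse relative to `e` and `f`. -/
theorem exists_relative_inverse {e f s : N} (he : IsIdempotentElem e) (hf : IsIdempotentElem f)
    (hr : GreenRLE e (s * f)) (hl : GreenLLE f (e * s)) :
    ∃ x, e * s * f * x = e ∧ x * (e * s * f) = f ∧ f * x = x ∧ x * e = x := by
  obtain ⟨z, hz⟩ := hr
  obtain ⟨t, ht⟩ := hl
  have hcz : e * s * f * z = e := by rw [mul_assoc e, mul_assoc e, ← hz, he]
  have htc : t * (e * s * f) = f := by rw [← mul_assoc, ← ht, hf]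
  have hec : e * (e * s * f) = e * s * f := by rw [← mul_assoc, ← mul_assoc, he]
  have hcf : e * s * f * f = e * s * f := by rw [mul_assoc, hf]
  -- Here `z` and `t` are one-sided inverses of `e s f`; multiplying by `f` and `e` makes `z`
  -- two-sided and gives the last two equations.
  refine ⟨f * z * e, ?_, ?_, ?_, ?_⟩
  · rw [← mul_assoc, ← mul_assoc, hcf, hcz, he]
  · rw [mul_assoc _ e, hec]
    calc f * z * (e * s * f) = t * (e * s * f * z) * (e * s * f) := by
          rw [← mul_assoc t, htc]
      _ = f := by rw [hcz, mul_assoc, hec, htc]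
  · rw [← mul_assoc, ← mul_assoc, hf]
  · rw [mul_assoc, he]

/-- No marker of an unambiguous concatenation lies between high powers of `u` and `w`. -/
theorem IsUnambiguous.not_marker_between {η : FreeMonoid A →* N} (hη : Function.Surjective η)
    {K L : Language A} {a : A} (hKL : IsUnambiguous K a L) {m : ℕ} (hm : 0 < m)
    (hK : ∀ u : FreeMonoid A, IsIdempotentElem (η u) → ∀ v : FreeMonoid A, η v = η u →
      ∀ x y : FreeMonoid A, (x * u ^ m * u * u ^ m * y).toList ∈ K →
        (x * u ^ m * v * u ^ m * y).toList ∈ K)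
    (hL : ∀ u : FreeMonoid A, IsIdempotentElem (η u) → ∀ v : FreeMonoid A, η v = η u →
      ∀ x y : FreeMonoid A, (x * u ^ m * u * u ^ m * y).toList ∈ L →
        (x * u ^ m * v * u ^ m * y).toList ∈ L)
    {u w x y k l : FreeMonoid A} (hu : IsIdempotentElem (η u)) (hw : IsIdempotentElem (η w)) {s : N}
    (hr : GreenRLE (η u) (s * η w)) (hl : GreenLLE (η w) (η u * s))
    (hkl : η (k * FreeMonoid.of a * l) = η u * s * η w)
    (hk : (x * u ^ m * u * u ^ m * k).toList ∈ K) (hl' : (l * w ^ m * w * w ^ m * y).toList ∈ L) :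
    False := by
  obtain ⟨g, hcg, hgc, hfg, hge⟩ := exists_relative_inverse hu hw hr hl
  obtain ⟨X, rfl⟩ := hη g
  set M := k * FreeMonoid.of a * l with hM
  have hup : η u ^ m = η u := hu.pow_eq hm.ne'
  have hwp : η w ^ m = η w := hw.pow_eq hm.ne'
  have hec : η u * η M = η M := by rw [hkl, ← mul_assoc, ← mul_assoc, hu]
  have hcf : η M * η w = η M := by rw [hkl, mul_assoc, hw]
  rw [← hkl] at hcg hgc
  -- Pump a second copy of `M` into each factor. The two resulting decompositions spell the same
  -- word, but mark different copies of `M`.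
  have h₁ := hK u hu (u * u ^ m * M * w ^ m * X) (by
    simp only [map_mul, map_pow, hup, hwp, hu.eq, hec, hcf, hcg]) x k hk
  have h₂ := hL w hw (X * u ^ m * M * w ^ m * w) (by
    simp only [map_mul, map_pow, hup, hwp, hge, hgc, hw.eq]) l y hl'
  have h := (hKL _ hk _ h₁ _ h₂ _ hl' (by
    have : x * u ^ m * u * u ^ m * k * FreeMonoid.of a *
        (l * w ^ m * (X * u ^ m * M * w ^ m * w) * w ^ m * y) =
        x * u ^ m * (u * u ^ m * M * w ^ m * X) * u ^ m * k * FreeMonoid.of a *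
        (l * w ^ m * w * w ^ m * y) := by
      simp only [hM, mul_assoc]
    exact this)).1
  -- The left factors differ in length by at least that of `M`, which contains the letter `a`.
  have h' := congrArg List.length h
  change FreeMonoid.length _ = FreeMonoid.length _ at h'
  simp only [FreeMonoid.length_mul, hM, FreeMonoid.length_of] at h'
  omega

/-- If the marker lies outside the central block, the swap takes place within one factor.
`IsUnambiguous.not_marker_between` excludes a marker inside the block. -/
theorem IsSwapStable.markedConcat {η : FreeMonoid A →* N} (hη : Function.Surjective η)
    {K L : Language A} {a : A} (hKL : IsUnambiguous K a L) (hK : IsSwapStable η K)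
    (hL : IsSwapStable η L) : IsSwapStable η (markedConcat K a L) := by
  obtain ⟨p, hp⟩ := hK
  obtain ⟨q, hq⟩ := hL
  set m := p + q + 1 with hm
  -- On each side, an outer block of `m + 1 + m` copies is there to be pumped, and at least `m`
  -- copies stay next to `v` for swapping inside a factor.
  refine ⟨(m + 1 + m) + m, fun i hi j hj u w hu hw v v' hv hr hl x y h => ?_⟩
  obtain ⟨i, rfl⟩ := Nat.exists_eq_add_of_le hi
  obtain ⟨j, rfl⟩ := Nat.exists_eq_add_of_le hj
  obtain ⟨k, l, hk, hl', h⟩ := mem_markedConcat.1 h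
  refine mem_markedConcat.2 ?_
  -- With both idempotents and the middle element equal to `η u`, swapping replaces a central `u` by
  -- any word with the same image.
  have hidem : ∀ u : FreeMonoid A, IsIdempotentElem (η u) → ∀ v : FreeMonoid A, η v = η u →
      η u = η v ∧ GreenRLE (η u) (η u * η u) ∧ GreenLLE (η u) (η u * η u) := fun u hu v hv =>
    ⟨hv.symm, ⟨1, by rw [mul_one, hu]⟩, ⟨1, by rw [one_mul, hu]⟩⟩
  have e' : ∀ v, x * u ^ (m + 1 + m + m + i) * v * w ^ (m + 1 + m + m + j) * y =
      (x * u ^ (m + 1 + m)) * ((u ^ (m + i) * v * w ^ (j + m)) * (w ^ (m + 1 + m) * y)) := by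
    intro v
    rw [add_assoc (m + 1 + m) m i, pow_add u _ (m + i),
      show m + 1 + m + m + j = (j + m) + (m + 1 + m) by omega, pow_add w (j + m)]
    simp only [mul_assoc]
  have e : (x * u ^ (m + 1 + m)) * ((u ^ (m + i) * v * w ^ (j + m)) * (w ^ (m + 1 + m) * y)) =
      k * FreeMonoid.of a * l := by
    rw [h, e']
  rcases mul_eq_mul_of_mul e with ⟨z, hz₁, rfl⟩ | ⟨z, rfl, hz⟩
  · refine ⟨k, z * ((u ^ (m + i) * v' * w ^ (j + m)) * (w ^ (m + 1 + m) * y)), hk, ?_, ?_⟩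
    · have := hq (m + i) (by omega) (j + m + (m + 1 + m)) (by omega) u w hu hw v v' hv hr hl z y
      rw [pow_add w (j + m)] at this
      simp only [mul_assoc] at this hl' ⊢
      exact this hl'
    · rw [e', hz₁]
      simp only [mul_assoc]
  · rcases mul_eq_mul_of_mul hz with ⟨z', hz₁, rfl⟩ | ⟨z', rfl, hz₁⟩
    · exfalso
      refine hKL.not_marker_between hη (m := m) (by omega) ?_ ?_ hu hw hr hl
        (x := x) (y := y) (k := z) (l := z') ?_ ?_ ?_
      · intro u hu v hv x y
        obtain ⟨h₁, h₂, h₃⟩ := hidem u hu v hv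
        exact hp m (by omega) m (by omega) u u hu hu u v h₁ h₂ h₃ x y
      · intro u hu v hv x y
        obtain ⟨h₁, h₂, h₃⟩ := hidem u hu v hv
        exact hq m (by omega) m (by omega) u u hu hu u v h₁ h₂ h₃ x y
      · rw [← hz₁]
        simp only [map_mul, map_pow]
        rw [hu.pow_eq (by omega), hw.pow_eq (by omega)]
      · simpa only [pow_add, pow_one, mul_assoc] using hk
      · simpa only [pow_add, pow_one, mul_assoc] using hl'
    · refine ⟨x * u ^ (m + 1 + m) * (u ^ (m + i) * v' * w ^ (j + m) * z'), l, ?_, hl', ?_⟩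
      · have := hp (m + 1 + m + (m + i)) (by omega) (j + m) (by omega) u w hu hw v v' hv hr hl x z'
        rw [pow_add u (m + 1 + m)] at this
        simp only [mul_assoc] at this hk ⊢
        exact this hk
      · rw [e', hz₁]
        simp only [mul_assoc]

theorem MemUPol.isSwapStable {C : Set (Language A)} {η : FreeMonoid A →* N}
    (hη : IsCanonicalMorphism C η) {L : Language A} (hL : MemUPol C L) : IsSwapStable η L := by
  induction hL with
  | base h =>
    obtain ⟨F, rfl⟩ := hη.recognizes _ h
    exact isSwapStable_recognized η F
  | disjointUnion _ _ _ ihK ihL => exact ihK.add ihL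
  | unambiguousConcat _ _ h ihK ihL => exact ihK.markedConcat hη.surjective h ihL

end Swap

/-! ## Imprints of covers are large -/

section Soundness

variable {A N R : Type*} [Monoid N] [IdemSemiring R]

/-- The words that are equivalent to `w` for `canonicalCon X`. -/
def conClass (X : Set (Language A)) (w : FreeMonoid A) : Language A :=
  {w' : List A | canonicalCon X (FreeMonoid.ofList w') w}

theorem conClass_mul_le (X : Set (Language A)) (v w : FreeMonoid A) :
    conClass X v * conClass X w ≤ conClass X (v * w) := by
  rintro _ ⟨v', hv, w', hw, rfl⟩
  exact (canonicalCon X).mul hv hw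

theorem conClass_pow_le (X : Set (Language A)) (w : FreeMonoid A) (n : ℕ) :
    conClass X w ^ n ≤ conClass X (w ^ n) := by
  induction n with
  | zero =>
    rw [pow_zero, pow_zero]
    rintro _ rfl
    exact (canonicalCon X).refl 1
  | succ n ih =>
    rw [pow_succ, pow_succ]
    exact (mul_le_mul_left ih _).trans (conClass_mul_le X _ _)

theorem ratingMap_mono (ρ : Language A →+* R) : Monotone ρ := by
  intro K L h
  rw [← add_eq_right_iff_le, ← map_add, add_eq_right_iff_le.2 h]

/-- The pairs `(η w, r)` with `r ≤ ρ(H)`, where `H` is the class of `w` for `canonicalCon X`. -/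
def classImprint (X : Set (Language A)) (η : FreeMonoid A →* N) (ρ : Language A →+* R) :
    Set (N × R) :=
  {p | ∃ w, η w = p.1 ∧ p.2 ≤ ρ (conClass X w)}

/-- Only the closure axiom uses swap-stability: an idempotent bounded by the image of a class is
also bounded by that of a high power, and between such powers all words of `η⁻¹(s)` are congruent.
-/
theorem isUPolSaturated_classImprint {X : Set (Language A)} (hX : X.Finite)
    {η : FreeMonoid A →* N} (hη : Function.Surjective η) (hs : ∀ L ∈ X, IsSwapStable η L)
    (ρ : Language A →+* R) : IsUPolSaturated η ρ (classImprint X η ρ) := by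
  refine ⟨fun w => ⟨FreeMonoid.ofList w, rfl, ratingMap_mono ρ ?_⟩, ?_, ?_, ?_⟩
  · rintro _ rfl
    exact (canonicalCon X).refl _
  · refine Set.Subset.antisymm ?_ fun p hp => ⟨p.2, le_rfl, hp⟩
    rintro p ⟨s, hps, w, hw, hs⟩
    exact ⟨w, hw, hps.trans hs⟩
  · rintro s₁ s₂ r₁ r₂ ⟨w₁, rfl, h₁⟩ ⟨w₂, rfl, h₂⟩
    refine ⟨w₁ * w₂, map_mul _ _ _, (mul_le_mul' h₁ h₂).trans ?_⟩
    rw [← map_mul]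
    exact ratingMap_mono ρ (conClass_mul_le X _ _)
  · rintro _ _ f₁ f₂ ⟨w₁, rfl, h₁⟩ ⟨w₂, rfl, h₂⟩ he₁ hf₁ he₂ hf₂ s hr hl
    choose! n hn using hs
    obtain ⟨m, hm⟩ : ∃ m, ∀ L ∈ X, n L ≤ m := by
      obtain ⟨m, hm⟩ := (hX.image n).bddAbove
      exact ⟨m, fun L hL => hm ⟨L, hL, rfl⟩⟩
    obtain ⟨v, rfl⟩ := hη s
    dsimp only at h₁ h₂ hr hl he₁ he₂ ⊢
    have hpow : ∀ {f : R} {w}, IsIdempotentElem f → f ≤ ρ (conClass X w) →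
        f ≤ ρ (conClass X (w ^ (m + 1))) := by
      intro f w hf h
      calc f = f ^ (m + 1) := (hf.pow_succ_eq m).symm
        _ ≤ ρ (conClass X w) ^ (m + 1) := pow_le_pow_left' h _
        _ = ρ (conClass X w ^ (m + 1)) := (map_pow ρ _ _).symm
        _ ≤ _ := ratingMap_mono ρ (conClass_pow_le X w _)
    refine ⟨w₁ ^ (m + 1) * v * w₂ ^ (m + 1), ?_, ?_⟩
    · simp only [map_mul, map_pow, he₁.pow_succ_eq, he₂.pow_succ_eq]
    · refine (mul_le_mul' (mul_le_mul' (hpow hf₁ h₁) le_rfl) (hpow hf₂ h₂)).trans ?_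
      rw [← map_mul, ← map_mul]
      refine ratingMap_mono ρ ?_
      rintro _ ⟨_, ⟨u₁, hu₁, v', hv', rfl⟩, u₂, hu₂, rfl⟩
      have hv : η (FreeMonoid.ofList v') = η v := hv'
      suffices h : canonicalCon X (w₁ ^ (m + 1) * FreeMonoid.ofList v' * w₂ ^ (m + 1))
          (w₁ ^ (m + 1) * v * w₂ ^ (m + 1)) from (canonicalCon X).trans
        ((canonicalCon X).mul ((canonicalCon X).mul hu₁ ((canonicalCon X).refl _)) hu₂) h
      intro L hL x y
      have key := fun v v' h h₁ h₂ => hn L hL (m + 1) (by have := hm L hL; omega) (m + 1)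
        (by have := hm L hL; omega) w₁ w₂ he₁ he₂ v v' h h₁ h₂ x y
      simp only [mul_assoc] at key ⊢
      -- Swapping is one-directional, so it is applied once each way.
      exact ⟨key _ _ hv (hv ▸ hr) (hv ▸ hl), key _ _ hv.symm hr hl⟩

/-- The imprint of a cover by swap-stable languages contains every pair that lies in all saturated
sets. -/
theorem mem_imprint_of_forall_saturated {η : FreeMonoid A →* N} (hη : Function.Surjective η)
    {ρ : Language A →+* R} {K : Finset (Language A)} (hs : ∀ L ∈ K, IsSwapStable η L)
    {t : N} {r : R} (hK : IsCover K (recognized η {t}))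
    (h : ∀ S : Set (N × R), IsUPolSaturated η ρ S → (t, r) ∈ S) : r ∈ imprint ρ K := by
  obtain ⟨w, hw, hr⟩ := h _ (isUPolSaturated_classImprint K.finite_toSet hη hs ρ)
  obtain ⟨H, hH, hwH⟩ := hK w.toList hw
  refine ⟨H, hH, hr.trans (ratingMap_mono ρ fun w' hw' => ?_)⟩
  have := hw' H hH 1 1
  simp only [one_mul, mul_one] at this
  exact this.2 hwH

end Soundness

/-! ## Finite monoids -/

section FiniteMonoid

variable {N : Type*} [Monoid N]

theorem exists_isIdempotentElem_pow [Finite N] (x : N) :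
    ∃ n : ℕ, IsIdempotentElem (x ^ (n + 1)) := by
  obtain ⟨a, b, hab, h⟩ := Finite.exists_ne_map_eq_of_infinite fun n : ℕ => x ^ n
  wlog hlt : a < b generalizing a b
  · exact this b a hab.symm h.symm (by omega)
  obtain ⟨d, rfl⟩ := Nat.exists_eq_add_of_lt hlt
  have hper : ∀ k c, x ^ (a + c + k * (d + 1)) = x ^ (a + c) := by
    intro k
    induction k with
    | zero => simp
    | succ k ih =>
      intro c
      rw [show a + c + (k + 1) * (d + 1) = (a + d + 1) + (c + k * (d + 1)) by ring, pow_add,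
        ← h, ← pow_add, ← add_assoc, ih]
  -- The exponent is `(a + 1) * (d + 1)`: a multiple of the period `d + 1` that is at least the
  -- index `a`.
  refine ⟨a + a * d + d, ?_⟩
  have h2 := hper (a + 1) (a * d + d + 1)
  rw [isIdempotentElem_iff, ← pow_add]
  convert h2 using 2 <;> ring

/-- `s ≤_J t` for the Green preorder: `s = x t y` for some `x` and `y`. -/
def GreenJLE (s t : N) : Prop := ∃ x y : N, s = x * t * y

theorem GreenJLE.refl (s : N) : GreenJLE s s := ⟨1, 1, by simp⟩

theorem GreenJLE.trans {s t u : N} (h₁ : GreenJLE s t) (h₂ : GreenJLE t u) : GreenJLE s u := by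
  obtain ⟨x, y, rfl⟩ := h₁
  obtain ⟨x', y', rfl⟩ := h₂
  exact ⟨x * x', y' * y, by simp only [mul_assoc]⟩

theorem greenJLE_mul_right (t y : N) : GreenJLE (t * y) t := ⟨1, y, by simp⟩

theorem greenJLE_mul_left (x t : N) : GreenJLE (x * t) t := ⟨x, 1, by simp⟩

/-- Stability of finite monoids: iterating `t = x t (z y)` up to an idempotent power of `z y` shows
that this power fixes `t` on the right. -/
theorem greenRLE_of_greenJLE_mul [Finite N] {t z : N} (h : GreenJLE t (t * z)) :
    GreenRLE t (t * z) := by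
  obtain ⟨x, y, h⟩ := h
  obtain ⟨n, hn⟩ := exists_isIdempotentElem_pow (z * y)
  have key : ∀ k, t = x ^ k * t * (z * y) ^ k := by
    intro k
    induction k with
    | zero => simp
    | succ k ih =>
      rw [pow_succ, pow_succ']
      calc t = x ^ k * (x * (t * z) * y) * (z * y) ^ k := by rw [← h]; exact ih
        _ = _ := by simp only [mul_assoc]
  have h1 : t * (z * y) ^ (n + 1) = t := by
    conv_lhs => rw [key (n + 1)]
    rw [mul_assoc, hn, ← key]
  refine ⟨y * (z * y) ^ n, ?_⟩
  rw [pow_succ'] at h1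
  simpa only [mul_assoc] using h1.symm

theorem greenLLE_of_greenJLE_mul [Finite N] {t z : N} (h : GreenJLE t (z * t)) :
    GreenLLE t (z * t) := by
  obtain ⟨x, y, h⟩ := h
  obtain ⟨n, hn⟩ := exists_isIdempotentElem_pow (x * z)
  have key : ∀ k, t = (x * z) ^ k * t * y ^ k := by
    intro k
    induction k with
    | zero => simp
    | succ k ih =>
      rw [pow_succ, pow_succ']
      calc t = (x * z) ^ k * (x * (z * t) * y) * y ^ k := by rw [← h]; exact ih
        _ = _ := by simp only [mul_assoc]
  have h1 : (x * z) ^ (n + 1) * t = t := by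
    conv_lhs => rw [key (n + 1)]
    rw [← mul_assoc, ← mul_assoc, hn, ← key]
  refine ⟨(x * z) ^ n * x, ?_⟩
  rw [pow_succ] at h1
  simpa only [mul_assoc] using h1.symm

end FiniteMonoid

/-! ## Covers with small imprints -/

section Completeness

variable {A N R : Type*} [Monoid N] [IdemSemiring R]

/-- The language `η⁻¹(t)` has a finite cover by languages `H ⊆ η⁻¹(t)` in `UPol C` such that
`p (t, ρ(H)) q ∈ S`. -/
def HasCover (C : Set (Language A)) (η : FreeMonoid A →* N) (ρ : Language A →+* R)
    (S : Set (N × R)) (p : N × R) (t : N) (q : N × R) : Prop :=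
  ∃ K : Set (Language A), K.Finite ∧
    (∀ H ∈ K, MemUPol C H ∧ H ≤ recognized η {t} ∧ p * (t, ρ H) * q ∈ S) ∧
    ∀ w : FreeMonoid A, η w = t → ∃ H ∈ K, w.toList ∈ H

variable {C : Set (Language A)} {η : FreeMonoid A →* N} {ρ : Language A →+* R} {S : Set (N × R)}

theorem IsUPolSaturated.mul {p q : N × R} (hS : IsUPolSaturated η ρ S) (hp : p ∈ S) (hq : q ∈ S) :
    p * q ∈ S := hS.mul_mem _ _ _ _ hp hq

theorem IsUPolSaturated.one (hS : IsUPolSaturated η ρ S) : (1 : N × R) ∈ S := by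
  have h := hS.trivial_mem []
  have h1 : ρ ({[]} : Language A) = 1 := map_one ρ
  rw [h1] at h
  have h2 : η (FreeMonoid.ofList []) = 1 := map_one η
  rw [h2] at h
  exact h

theorem IsUPolSaturated.pow {p : N × R} (hS : IsUPolSaturated η ρ S) (hp : p ∈ S) (n : ℕ) :
    p ^ n ∈ S := by
  induction n with
  | zero => simpa using hS.one
  | succ n ih =>
    rw [pow_succ]
    exact hS.mul ih hp

theorem HasCover.of_one (hS : IsUPolSaturated η ρ S) {p q : N × R} (hp : p ∈ S) (hq : q ∈ S) {t : N}
    (h : HasCover C η ρ S 1 t 1) : HasCover C η ρ S p t q := by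
  obtain ⟨K, hf, hK, hc⟩ := h
  refine ⟨K, hf, fun H hH => ⟨(hK H hH).1, (hK H hH).2.1, ?_⟩, hc⟩
  have := (hK H hH).2.2
  rw [one_mul, mul_one] at this
  exact hS.mul (hS.mul hp this) hq

/-! ### Cutting words at an unambiguous marker -/

theorem markedConcat_le_recognized {H₁ H₂ : Language A} {a : A} {t₁ t₂ : N}
    (h₁ : H₁ ≤ recognized η {t₁}) (h₂ : H₂ ≤ recognized η {t₂}) :
    markedConcat H₁ a H₂ ≤ recognized η {t₁ * η (FreeMonoid.of a) * t₂} := by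
  intro w hw
  obtain ⟨k, l, hk, hl, h⟩ := (mem_markedConcat (w := FreeMonoid.ofList w)).1 hw
  have hk' : η k = t₁ := h₁ hk
  have hl' : η l = t₂ := h₂ hl
  change η (FreeMonoid.ofList w) = _
  rw [← h, map_mul, map_mul, hk', hl']

/-- A marker that leaves the set of elements strictly `J`-above `t` from the left is
unambiguous. -/
theorem isUnambiguous_of_left {H₁ H₂ : Language A} {a : A} {t t₁ : N}
    (h₁ : H₁ ≤ recognized η {t₁}) (ht₁ : ¬ GreenJLE t₁ t)
    (hta : GreenJLE (t₁ * η (FreeMonoid.of a)) t) : IsUnambiguous H₁ a H₂ := by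
  -- A longer left factor would extend `u a`, which puts `t₁` `J`-below `t₁ η(a)` and hence below
  -- `t`.
  have key : ∀ u ∈ H₁, ∀ u' ∈ H₁, ∀ v v' : List A, u ++ [a] ++ v = u' ++ [a] ++ v' →
      ¬ ∃ z, u' = u ++ a :: z := by
    rintro u hu u' hu' v v' h ⟨z, rfl⟩
    have hu : η (FreeMonoid.ofList u) = t₁ := h₁ hu
    have hu' : η (FreeMonoid.ofList u * FreeMonoid.of a * FreeMonoid.ofList z) = t₁ := by
      refine Eq.trans ?_ (h₁ hu')
      congr 1
      apply FreeMonoid.toList.injective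
      simp
    rw [map_mul, map_mul, hu] at hu'
    apply ht₁
    rw [← hu']
    exact (greenJLE_mul_right _ _).trans hta
  intro u hu u' hu' v hv v' hv' h
  have h' : u ++ (a :: v) = u' ++ (a :: v') := by simpa using h
  rcases List.append_eq_append_iff.1 h' with ⟨z, h₁, h₂⟩ | ⟨z, h₁, h₂⟩
  · rcases z with _ | ⟨b, z⟩
    · simp_all
    · simp only [List.cons_append, List.cons.injEq] at h₂
      obtain ⟨rfl, h₂⟩ := h₂
      exact absurd ⟨z, h₁⟩ (key u hu u' hu' v v' h)
  · rcases z with _ | ⟨b, z⟩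
    · simp_all
    · simp only [List.cons_append, List.cons.injEq] at h₂
      obtain ⟨rfl, h₂⟩ := h₂
      exact absurd ⟨z, h₁⟩ (key u' hu' u hu v' v h.symm)

/-- A marker that leaves the set of elements strictly `J`-above `t` from the right is
unambiguous. -/
theorem isUnambiguous_of_right {H₁ H₂ : Language A} {a : A} {t t₂ : N}
    (h₂ : H₂ ≤ recognized η {t₂}) (ht₂ : ¬ GreenJLE t₂ t)
    (hta : GreenJLE (η (FreeMonoid.of a) * t₂) t) : IsUnambiguous H₁ a H₂ := by
  have key : ∀ v ∈ H₂, ∀ v' ∈ H₂, ¬ ∃ z, v' = z ++ a :: v := by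
    rintro v hv v' hv' ⟨z, rfl⟩
    have hv : η (FreeMonoid.ofList v) = t₂ := h₂ hv
    have hv' : η (FreeMonoid.ofList z * (FreeMonoid.of a * FreeMonoid.ofList v)) = t₂ := by
      refine Eq.trans ?_ (h₂ hv')
      congr 1
    rw [map_mul, map_mul, hv] at hv'
    apply ht₂
    rw [← hv']
    exact (greenJLE_mul_left _ _).trans hta
  intro u hu u' hu' v hv v' hv' h
  have h' : u ++ (a :: v) = u' ++ (a :: v') := by simpa using h
  rcases List.append_eq_append_iff.1 h' with ⟨z, h₁, h₂⟩ | ⟨z, h₁, h₂⟩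
  · rcases z with _ | ⟨b, z⟩
    · simp_all
    · simp only [List.cons_append, List.cons.injEq] at h₂
      obtain ⟨rfl, h₂⟩ := h₂
      exact absurd ⟨z, h₂⟩ (key v' hv' v hv)
  · rcases z with _ | ⟨b, z⟩
    · simp_all
    · simp only [List.cons_append, List.cons.injEq] at h₂
      obtain ⟨rfl, h₂⟩ := h₂
      exact absurd ⟨z, h₂⟩ (key v hv v' hv')

theorem exists_first_exit {P : FreeMonoid A → Prop} (h1 : P 1) (w : FreeMonoid A) (hw : ¬ P w) :
    ∃ u a v, w = u * FreeMonoid.of a * v ∧ P u ∧ ¬ P (u * FreeMonoid.of a) := by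
  induction w using FreeMonoid.recOn generalizing P with
  | one => exact absurd h1 hw
  | of_mul a w ih =>
    by_cases ha : P (FreeMonoid.of a)
    -- Prefixes of the whole word start with `a`, so the induction runs on the predicate translated
    -- by `a`.
    · obtain ⟨u, b, v, rfl, hu, hub⟩ := ih (P := fun u => P (FreeMonoid.of a * u))
        (by simpa using ha) hw
      exact ⟨FreeMonoid.of a * u, b, v, by simp only [mul_assoc], hu, by rwa [mul_assoc]⟩
    · exact ⟨1, a, w, by simp, h1, by simpa using ha⟩

theorem exists_last_exit {P : FreeMonoid A → Prop} (h1 : P 1) (w : FreeMonoid A) (hw : ¬ P w) :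
    ∃ u a v, w = u * FreeMonoid.of a * v ∧ P v ∧ ¬ P (FreeMonoid.of a * v) := by
  induction w using FreeMonoid.recOn with
  | one => exact absurd h1 hw
  | of_mul a w ih =>
    by_cases ha : P w
    · exact ⟨1, a, w, by simp, ha, hw⟩
    · obtain ⟨u, b, v, rfl, hv, hbv⟩ := ih ha
      exact ⟨FreeMonoid.of a * u, b, v, by simp only [mul_assoc], hv, hbv⟩

theorem map_markedConcat (ρ : Language A →+* R) (H₁ H₂ : Language A) (a : A) :
    ρ (markedConcat H₁ a H₂) = ρ H₁ * ρ ({[a]} : Language A) * ρ H₂ := by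
  rw [markedConcat, map_mul, map_mul]

/-- The trivial element of a letter. -/
def letterPair (η : FreeMonoid A →* N) (ρ : Language A →+* R) (a : A) : N × R :=
  (η (FreeMonoid.of a), ρ ({[a]} : Language A))

/-- Each word is cut at its first prefix that is `J`-below `t`. The cover of the suffix may depend
on the piece `H₁` chosen for the prefix, but only through `ρ H₁`, which joins the left context. -/
theorem HasCover.of_left_splits [Finite A] [Finite N] {p q : N × R} {t : N}
    (h1 : ¬ GreenJLE 1 t)
    (hJ : ∀ t₁, GreenJLE t t₁ → ¬ GreenJLE t₁ t → HasCover C η ρ S 1 t₁ 1)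
    (hsplit : ∀ t₁ a t₂ r, ¬ GreenJLE t₁ t → GreenJLE (t₁ * η (FreeMonoid.of a)) t →
      t₁ * η (FreeMonoid.of a) * t₂ = t → (t₁, r) ∈ S →
      HasCover C η ρ S (p * ((t₁, r) * letterPair η ρ a)) t₂ q) :
    HasCover C η ρ S p t q := by
  classical
  choose! K hKf hK hKc using hJ
  choose! K' hK'f hK' hK'c using hsplit
  let I : Set (N × A × N) := {i | ¬ GreenJLE i.1 t ∧ GreenJLE (i.1 * η (FreeMonoid.of i.2.1)) t ∧
    i.1 * η (FreeMonoid.of i.2.1) * i.2.2 = t}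
  have hI : ∀ i ∈ I, GreenJLE t i.1 := by
    rintro ⟨t₁, a, t₂⟩ ⟨-, -, h⟩
    dsimp only at h ⊢
    rw [← h, mul_assoc]
    exact greenJLE_mul_right _ _
  have hmem : ∀ i ∈ I, ∀ H₁ ∈ K i.1, (i.1, ρ H₁) ∈ S := fun i hi H₁ hH₁ => by
    simpa using (hK i.1 (hI i hi) hi.1 H₁ hH₁).2.2
  refine ⟨⋃ i ∈ I, ⋃ H₁ ∈ K i.1, (markedConcat H₁ i.2.1) '' K' i.1 i.2.1 i.2.2 (ρ H₁), ?_, ?_, ?_⟩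
  · refine I.toFinite.biUnion fun i hi => (hKf _ (hI i hi) hi.1).biUnion fun H₁ hH₁ =>
      (hK'f _ _ _ _ hi.1 hi.2.1 hi.2.2 (hmem i hi H₁ hH₁)).image _
  · intro H hH
    simp only [Set.mem_iUnion] at hH
    obtain ⟨⟨t₁, a, t₂⟩, hi, H₁, hH₁, H₂, hH₂, rfl⟩ := hH
    obtain ⟨hU₁, hle₁, -⟩ := hK t₁ (hI _ hi) hi.1 H₁ hH₁
    obtain ⟨hU₂, hle₂, hm⟩ := hK' _ _ _ _ hi.1 hi.2.1 hi.2.2 (hmem _ hi H₁ hH₁) H₂ hH₂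
    have ht : t₁ * η (FreeMonoid.of a) * t₂ = t := hi.2.2
    refine ⟨hU₁.unambiguousConcat hU₂ (isUnambiguous_of_left hle₁ hi.1 hi.2.1), ?_, ?_⟩
    · have := markedConcat_le_recognized (a := a) hle₁ hle₂
      rwa [ht] at this
    · convert hm using 2
      rw [map_markedConcat, mul_assoc p]
      congr 1
      simp [letterPair, ht]
  · intro w hw
    obtain ⟨u, a, v, rfl, hu, hua⟩ := exists_first_exit (P := fun u => ¬ GreenJLE (η u) t)
      (by simpa using h1) w (by simpa [hw] using GreenJLE.refl t)
    rw [not_not, map_mul] at hua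
    rw [map_mul, map_mul] at hw
    have hi : (η u, a, η v) ∈ I := ⟨hu, hua, hw⟩
    obtain ⟨H₁, hH₁, huH⟩ := hKc _ (hI _ hi) hu u rfl
    obtain ⟨H₂, hH₂, hvH⟩ := hK'c _ _ _ _ hu hua hw (hmem _ hi H₁ hH₁) v rfl
    refine ⟨markedConcat H₁ a H₂, ?_, mem_markedConcat.2 ⟨u, v, huH, hvH, rfl⟩⟩
    simp only [Set.mem_iUnion]
    exact ⟨_, hi, H₁, hH₁, H₂, hH₂, rfl⟩

theorem HasCover.of_right_splits [Finite A] [Finite N] {p q : N × R} {t : N}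
    (h1 : ¬ GreenJLE 1 t)
    (hJ : ∀ t₂, GreenJLE t t₂ → ¬ GreenJLE t₂ t → HasCover C η ρ S 1 t₂ 1)
    (hsplit : ∀ t₁ a t₂ r, ¬ GreenJLE t₂ t → GreenJLE (η (FreeMonoid.of a) * t₂) t →
      t₁ * (η (FreeMonoid.of a) * t₂) = t → (t₂, r) ∈ S →
      HasCover C η ρ S p t₁ (letterPair η ρ a * (t₂, r) * q)) :
    HasCover C η ρ S p t q := by
  classical
  choose! K hKf hK hKc using hJ
  choose! K' hK'f hK' hK'c using hsplit
  let I : Set (N × A × N) := {i | ¬ GreenJLE i.2.2 t ∧ GreenJLE (η (FreeMonoid.of i.2.1) * i.2.2) t ∧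
    i.1 * (η (FreeMonoid.of i.2.1) * i.2.2) = t}
  have hI : ∀ i ∈ I, GreenJLE t i.2.2 := by
    rintro ⟨t₁, a, t₂⟩ ⟨-, -, h⟩
    dsimp only at h ⊢
    rw [← h, ← mul_assoc]
    exact greenJLE_mul_left _ _
  have hmem : ∀ i ∈ I, ∀ H₂ ∈ K i.2.2, (i.2.2, ρ H₂) ∈ S := fun i hi H₂ hH₂ => by
    simpa using (hK i.2.2 (hI i hi) hi.1 H₂ hH₂).2.2
  refine ⟨⋃ i ∈ I, ⋃ H₂ ∈ K i.2.2,
    (fun H₁ => markedConcat H₁ i.2.1 H₂) '' K' i.1 i.2.1 i.2.2 (ρ H₂), ?_, ?_, ?_⟩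
  · refine I.toFinite.biUnion fun i hi => (hKf _ (hI i hi) hi.1).biUnion fun H₂ hH₂ =>
      (hK'f _ _ _ _ hi.1 hi.2.1 hi.2.2 (hmem i hi H₂ hH₂)).image _
  · intro H hH
    simp only [Set.mem_iUnion] at hH
    obtain ⟨⟨t₁, a, t₂⟩, hi, H₂, hH₂, H₁, hH₁, rfl⟩ := hH
    obtain ⟨hU₂, hle₂, -⟩ := hK t₂ (hI _ hi) hi.1 H₂ hH₂
    obtain ⟨hU₁, hle₁, hm⟩ := hK' _ _ _ _ hi.1 hi.2.1 hi.2.2 (hmem _ hi H₂ hH₂) H₁ hH₁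
    have ht : t₁ * (η (FreeMonoid.of a) * t₂) = t := hi.2.2
    refine ⟨hU₁.unambiguousConcat hU₂ (isUnambiguous_of_right hle₂ hi.1 hi.2.1), ?_, ?_⟩
    · have := markedConcat_le_recognized (a := a) hle₁ hle₂
      rwa [mul_assoc, ht] at this
    · convert hm using 1
      have : (t, ρ (markedConcat H₁ a H₂)) = (t₁, ρ H₁) * (letterPair η ρ a * (t₂, ρ H₂)) := by
        simp [letterPair, ht, map_markedConcat, mul_assoc]
      rw [this]
      simp only [mul_assoc]
  · intro w hw
    obtain ⟨u, a, v, rfl, hv, hav⟩ := exists_last_exit (P := fun u => ¬ GreenJLE (η u) t)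
      (by simpa using h1) w (by simpa [hw] using GreenJLE.refl t)
    rw [not_not, map_mul] at hav
    rw [mul_assoc, map_mul, map_mul] at hw
    have hi : (η u, a, η v) ∈ I := ⟨hv, hav, hw⟩
    obtain ⟨H₂, hH₂, hvH⟩ := hKc _ (hI _ hi) hv v rfl
    obtain ⟨H₁, hH₁, huH⟩ := hK'c _ _ _ _ hv hav hw (hmem _ hi H₂ hH₂) u rfl
    refine ⟨markedConcat H₁ a H₂, ?_, mem_markedConcat.2 ⟨u, v, huH, hvH, rfl⟩⟩
    simp only [Set.mem_iUnion]
    exact ⟨_, hi, H₂, hH₂, H₁, hH₁, rfl⟩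

/-- If idempotents of `S` that begin and end with `t` stabilize `p` and `q`, then the language
`η⁻¹(t)` is itself a cover. -/
theorem HasCover.of_stable [Finite N] (hC : ∀ t, recognized η {t} ∈ C)
    (hS : IsUPolSaturated η ρ S) {p q : N × R} (hp : p ∈ S) (hq : q ∈ S) {t : N}
    (hJ : GreenJLE t (p.1 * t * q.1))
    (hl : ∃ e ∈ S, IsIdempotentElem e ∧ p * e = p ∧ GreenRLE e.1 t)
    (hr : ∃ e ∈ S, IsIdempotentElem e ∧ e * q = q ∧ GreenLLE e.1 t) : HasCover C η ρ S p t q := by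
  refine ⟨{recognized η {t}}, Set.finite_singleton _, ?_,
    fun w hw => ⟨_, rfl, hw⟩⟩
  rintro _ rfl
  refine ⟨.base (hC t), le_rfl, ?_⟩
  obtain ⟨⟨e₁, f₁⟩, he, hei, hpe, z, hz⟩ := hl
  obtain ⟨⟨e₂, f₂⟩, he', hei', hqe, z', hz'⟩ := hr
  dsimp only at hz hz'
  have hp1 : p.1 * e₁ = p.1 := congrArg Prod.fst hpe
  have hq1 : e₂ * q.1 = q.1 := congrArg Prod.fst hqe
  have i₁ : e₁ * e₁ = e₁ := congrArg Prod.fst hei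
  have i₂ : e₂ * e₂ = e₂ := congrArg Prod.fst hei'
  have h₁ : e₁ * t = t := by
    have : GreenJLE t (t * z) := by
      -- Since `p` absorbs `e₁ = t z`, this element can be inserted before `t` in `p t q`; then `t`
      -- is `R`-below `e₁`.
      refine hJ.trans ⟨p.1, t * q.1, ?_⟩
      rw [← hz, hp1, mul_assoc]
    obtain ⟨y, hy⟩ := greenRLE_of_greenJLE_mul this
    rw [← hz] at hy
    rw [hy, ← mul_assoc, i₁]
  have h₂ : t * e₂ = t := by
    have : GreenJLE t (z' * t) := by
      refine hJ.trans ⟨p.1 * t, q.1, ?_⟩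
      rw [← hz', mul_assoc _ e₂, hq1]
    obtain ⟨y, hy⟩ := greenLLE_of_greenJLE_mul this
    rw [← hz'] at hy
    rw [hy, mul_assoc, i₂]
  have h := hS.upol_closure e₁ e₂ f₁ f₂ he he' i₁ (congrArg Prod.snd hei) i₂
    (congrArg Prod.snd hei') t ⟨z, by rw [h₂, hz]⟩ ⟨z', by rw [h₁, hz']⟩
  have h' := hS.mul (hS.mul hp h) hq
  have e : p * (e₁ * t * e₂, f₁ * ρ (recognized η {t}) * f₂) * q =
      p * (e₁, f₁) * (t, ρ (recognized η {t})) * ((e₂, f₂) * q) := by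
    rw [← Prod.mk_mul_mk, ← Prod.mk_mul_mk]
    simp only [mul_assoc]
  rwa [e, hpe, hqe] at h'

/-- The right ideal of `S` generated by `p`. -/
def rightIdeal (S : Set (N × R)) (p : N × R) : Set (N × R) := (fun x => p * x) '' S

/-- The left ideal of `S` generated by `q`. -/
def leftIdeal (S : Set (N × R)) (q : N × R) : Set (N × R) := (fun x => x * q) '' S

/-- If the ideals were equal, then `p = p x y` for some `y ∈ S`, and an idempotent power of `x y`
would be the forbidden stabilizer of `p`. -/
theorem ncard_rightIdeal_lt [Finite N] [Finite R] (hS : IsUPolSaturated η ρ S) {p x : N × R}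
    (hx : x ∈ S) {t : N} (hxt : GreenRLE x.1 t)
    (hp : ¬ ∃ e ∈ S, IsIdempotentElem e ∧ p * e = p ∧ GreenRLE e.1 t) :
    (rightIdeal S (p * x)).ncard < (rightIdeal S p).ncard := by
  refine Set.ncard_lt_ncard ⟨?_, fun h => hp ?_⟩ (Set.toFinite _)
  · rintro _ ⟨y, hy, rfl⟩
    exact ⟨x * y, hS.mul hx hy, (mul_assoc _ _ _).symm⟩
  · obtain ⟨y, hy, hpy⟩ := h ⟨1, hS.one, mul_one p⟩
    have hpy : p * (x * y) = p := by rw [← mul_assoc]; exact hpy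
    obtain ⟨n, hn⟩ := exists_isIdempotentElem_pow (x * y)
    refine ⟨_, hS.pow (hS.mul hx hy) (n + 1), hn, ?_, ?_⟩
    · have : ∀ k, p * (x * y) ^ k = p := by
        intro k
        induction k with
        | zero => simp
        | succ k ih => rw [pow_succ, ← mul_assoc, ih, hpy]
      exact this _
    · obtain ⟨z, hz⟩ := hxt
      refine ⟨z * (y * (x * y) ^ n).1, ?_⟩
      rw [← mul_assoc, ← hz, pow_succ', mul_assoc x]
      rfl

theorem ncard_leftIdeal_lt [Finite N] [Finite R] (hS : IsUPolSaturated η ρ S) {q x : N × R}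
    (hx : x ∈ S) {t : N} (hxt : GreenLLE x.1 t)
    (hq : ¬ ∃ e ∈ S, IsIdempotentElem e ∧ e * q = q ∧ GreenLLE e.1 t) :
    (leftIdeal S (x * q)).ncard < (leftIdeal S q).ncard := by
  refine Set.ncard_lt_ncard ⟨?_, fun h => hq ?_⟩ (Set.toFinite _)
  · rintro _ ⟨y, hy, rfl⟩
    exact ⟨y * x, hS.mul hy hx, mul_assoc _ _ _⟩
  · obtain ⟨y, hy, hqy⟩ := h ⟨1, hS.one, one_mul q⟩
    have hqy : y * x * q = q := by rw [mul_assoc]; exact hqy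
    obtain ⟨n, hn⟩ := exists_isIdempotentElem_pow (y * x)
    refine ⟨_, hS.pow (hS.mul hy hx) (n + 1), hn, ?_, ?_⟩
    · have : ∀ k, (y * x) ^ k * q = q := by
        intro k
        induction k with
        | zero => simp
        | succ k ih => rw [pow_succ, mul_assoc, hqy, ih]
      exact this _
    · obtain ⟨z, hz⟩ := hxt
      refine ⟨((y * x) ^ n * y).1 * z, ?_⟩
      rw [mul_assoc, ← hz, pow_succ, ← mul_assoc _ y]
      rfl

/-- The context is kept so that the closure axiom is needed only once `p` and `q` absorb the
idempotents it introduces. The hypothesis `hJ` says that the context does not push `t` into a lower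
`J`-class. -/
theorem hasCover [Finite A] [Finite N] [Finite R] (hC : ∀ t, recognized η {t} ∈ C)
    (hS : IsUPolSaturated η ρ S) {p q : N × R} (hp : p ∈ S) (hq : q ∈ S) {t : N}
    (hJ : GreenJLE t (p.1 * t * q.1)) : HasCover C η ρ S p t q := by
  obtain ⟨n, hn⟩ : ∃ n, {x | GreenJLE t x}.ncard < n := ⟨_, Nat.lt_succ_self _⟩
  induction n generalizing p q t with
  | zero => omega
  | succ n ihn =>
  obtain ⟨m, hm⟩ : ∃ m, (rightIdeal S p).ncard + (leftIdeal S q).ncard < m :=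
    ⟨_, Nat.lt_succ_self _⟩
  induction m generalizing p q t with
  | zero => omega
  | succ m ihm =>
  have habove : ∀ t', GreenJLE t t' → ¬ GreenJLE t' t → HasCover C η ρ S 1 t' 1 := by
    intro t' h h'
    refine ihn hS.one hS.one ⟨1, 1, by simp⟩ (lt_of_lt_of_le ?_ (Nat.lt_succ_iff.1 hn))
    exact Set.ncard_lt_ncard ⟨fun x hx => h.trans hx, fun hs => h' (hs (GreenJLE.refl t))⟩
      (Set.toFinite _)
  have hle : ∀ t', GreenJLE t t' → {x | GreenJLE t' x}.ncard < n + 1 := fun t' h =>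
    lt_of_le_of_lt (Set.ncard_le_ncard (fun x hx => h.trans hx) (Set.toFinite _)) hn
  have hletter : ∀ a, letterPair η ρ a ∈ S := fun a => hS.trivial_mem [a]
  by_cases hl : ∃ e ∈ S, IsIdempotentElem e ∧ p * e = p ∧ GreenRLE e.1 t
  · by_cases hr : ∃ e ∈ S, IsIdempotentElem e ∧ e * q = q ∧ GreenLLE e.1 t
    · exact HasCover.of_stable hC hS hp hq hJ hl hr
    · refine HasCover.of_right_splits (fun h1 => hr ?_) habove fun t₁ a t₂ r ht₂ hta ht hr₂ => ?_
      -- Were `1` `J`-below `t`, the neutral element would already stabilize `q`; so the empty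
      -- suffix is never the exit point.
      · exact ⟨1, hS.one, .one, one_mul q, by
          simpa using greenLLE_of_greenJLE_mul (t := 1) (z := t) (by simpa using h1)⟩
      have hx := hS.mul (hletter a) hr₂
      have htt₁ : GreenJLE t t₁ := by rw [← ht]; exact greenJLE_mul_right _ _
      by_cases ht₁ : GreenJLE t₁ t
      · refine ihm hp (hS.mul hx hq) ?_ (hle _ htt₁) ?_
        · refine ht₁.trans (hJ.trans ?_)
          rw [← ht]
          refine ⟨1, 1, ?_⟩
          simp [letterPair, mul_assoc]
        · have hR : GreenLLE (letterPair η ρ a * (t₂, r)).1 t := by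
            have h := greenLLE_of_greenJLE_mul (t := η (FreeMonoid.of a) * t₂) (z := t₁) (by rwa [ht])
            rwa [ht] at h
          have := ncard_leftIdeal_lt hS hx hR hr
          omega
      · exact (habove _ htt₁ ht₁).of_one hS hp (hS.mul hx hq)
  · refine HasCover.of_left_splits (fun h1 => hl ?_) habove fun t₁ a t₂ r ht₁ hta ht hr₁ => ?_
    · exact ⟨1, hS.one, .one, mul_one p, by
        simpa using greenRLE_of_greenJLE_mul (t := 1) (z := t) (by simpa using h1)⟩
    have hx := hS.mul hr₁ (hletter a)
    have htt₂ : GreenJLE t t₂ := by rw [← ht]; exact greenJLE_mul_left _ _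
    -- Either the suffix stays in the `J`-class of `t` and `pS` shrinks, or it is strictly above and
    -- a context-free cover exists.
    by_cases ht₂ : GreenJLE t₂ t
    · refine ihm (hS.mul hp hx) hq ?_ (hle _ htt₂) ?_
      · refine ht₂.trans (hJ.trans ?_)
        rw [← ht]
        refine ⟨1, 1, ?_⟩
        simp [letterPair, mul_assoc]
      · have hR : GreenRLE ((t₁, r) * letterPair η ρ a).1 t := by
          change GreenRLE (t₁ * η (FreeMonoid.of a)) t
          rw [← ht]
          exact greenRLE_of_greenJLE_mul (by rwa [ht])
        have := ncard_rightIdeal_lt hS hx hR hl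
        omega
    · exact (habove _ htt₂ ht₂).of_one hS (hS.mul hp hx) hq

/-! ### Optimal covers and the least saturated set -/

theorem exists_isCoverIn_imprint_subset [Finite A] [Finite N] [Finite R]
    (hC : ∀ t, recognized η {t} ∈ C) (hS : IsUPolSaturated η ρ S) (t : N) :
    ∃ K : Finset (Language A), IsCoverIn (UPol C) K (recognized η {t}) ∧
      ∀ r ∈ imprint ρ K, (t, r) ∈ S := by
  obtain ⟨K, hf, hK, hc⟩ := hasCover hC hS hS.one hS.one (t := t) ⟨1, 1, by simp⟩
  refine ⟨hf.toFinset, ⟨fun w hw => ?_, fun H hH => ?_⟩, ?_⟩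
  · obtain ⟨H, hH, hwH⟩ := hc (FreeMonoid.ofList w) hw
    exact ⟨H, hf.mem_toFinset.2 hH, hwH⟩
  · exact (hK H (hf.mem_toFinset.1 hH)).1
  · rintro r ⟨H, hH, hr⟩
    have := (hK H (hf.mem_toFinset.1 hH)).2.2
    rw [one_mul, mul_one] at this
    rw [← hS.downset_eq]
    exact ⟨ρ H, hr, this⟩

/-- The least saturated set. -/
theorem isUPolSaturated_sInter (η : FreeMonoid A →* N) (ρ : Language A →+* R) :
    IsUPolSaturated η ρ (⋂₀ {S | IsUPolSaturated η ρ S}) := by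
  refine ⟨fun w S hS => hS.trivial_mem w, ?_, ?_, ?_⟩
  · refine Set.Subset.antisymm ?_ fun p hp => ⟨p.2, le_rfl, hp⟩
    rintro p ⟨s, hps, hs⟩ S hS
    rw [← IsUPolSaturated.downset_eq hS]
    exact ⟨s, hps, hs S hS⟩
  · exact fun s₁ s₂ r₁ r₂ h₁ h₂ S hS => hS.mul_mem _ _ _ _ (h₁ S hS) (h₂ S hS)
  · exact fun e₁ e₂ f₁ f₂ h₁ h₂ he₁ hf₁ he₂ hf₂ s hr hl S hS =>
      hS.upol_closure _ _ _ _ (h₁ S hS) (h₂ S hS) he₁ hf₁ he₂ hf₂ s hr hl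

theorem pointedOptimalImprint_eq_sInter [Finite A] [Finite R] (hη : IsCanonicalMorphism C η)
    (ρ : Language A →+* R) :
    pointedOptimalImprint (UPol C) η ρ = ⋂₀ {S | IsUPolSaturated η ρ S} := by
  have := hη.finite
  ext ⟨t, r⟩
  obtain ⟨K, hK, hKS⟩ := exists_isCoverIn_imprint_subset (fun t => hη.recognized_mem {t})
    (isUPolSaturated_sInter η ρ) t
  have hsub : ∀ K', IsCoverIn (UPol C) K' (recognized η {t}) → ∀ r,
      (t, r) ∈ ⋂₀ {S | IsUPolSaturated η ρ S} → r ∈ imprint ρ K' := fun K' hK' r hr =>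
    mem_imprint_of_forall_saturated hη.surjective (fun L hL => (hK'.2 L hL).isSwapStable hη) hK'.1
      fun S hS => hr S hS
  -- The imprint of `K` lies in the fibre of the least saturated set, which in turn lies in every
  -- competing imprint.
  have hopt : IsOptimalCover (UPol C) ρ K (recognized η {t}) :=
    ⟨hK, fun K' hK' r hr => hsub K' hK' r (hKS r hr)⟩
  change r ∈ optimalImprint _ _ _ ↔ _
  rw [hopt.optimalImprint_eq]
  exact ⟨hKS r, hsub K hK r⟩

end Completeness

end UPolImprint

theorem mainTheorem6 {A : Type*} [Finite A]
    (C : Set (Language A)) (hC : UPolImprint.IsPrevariety C) (hfin : C.Finite)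
    {N : Type*} [Monoid N] (η : FreeMonoid A →* N) (hη : UPolImprint.IsCanonicalMorphism C η)
    {R : Type*} [IdemSemiring R] [Finite R] (ρ : Language A →+* R) :
    IsLeast {S : Set (N × R) | UPolImprint.IsUPolSaturated η ρ S}
      (UPolImprint.pointedOptimalImprint (UPolImprint.UPol C) η ρ) := by
  rw [UPolImprint.pointedOptimalImprint_eq_sInter hη ρ]
  exact ⟨UPolImprint.isUPolSaturated_sInter η ρ, fun _ hS => Set.sInter_subset_of_mem hS⟩
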